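/- Let $k$ be an algebraically closed field of characteristic $0$. Definitions. A filtration $F_\bullet$ of a finite-dimensional Lie algebra $L$ over $k$ is a decreasing sequence of subspaces $F_m$ ($m\in\mathbb Z$) with $[F_i,F_j]\subseteq F_{i+j}$, $F_m=L$ for $m\ll 0$ and $F_m=0$ for $m\gg 0$. Put $$\mathrm{wt}(F_\bullet)=\sum_{m\in\mathbb Z} m\dim(F_m/F_{m+1}),\qquad \|F_\bullet\|=\Big(\sum_{m\in\mathbb Z} m^2\dim(F_m/F_{m+1})\Big)^{1/2},\qquad \nu(F_\bullet)=\frac{-\mathrm{wt}(F_\bullet)}{\|F_\bullet\|},$$ with $\nu=0$ for the trivial filtration ($F_m=L$ for $m\le 0$, $F_m=0$ for $m>0$). $L$ is semistable if $-\mathrm{wt}(F_\bullet)\ge 0$ for every filtration, and unstable otherwise. A canonical filtration of $L$ is the trivial filtration if $L$ is semistable, and a filtration minimizing $\nu$ among all filtrations if $L$ is unstable. In the unstable case $\nu$ does not change when all weights (the $m$ with $F_m\ne F_{m+1}$) are multiplied by a positive integer $c$, i.e. when $F_m$ is replaced by $F_{\lceil m/c\rceil}$; the canonical filtration $F(L)^{\mathrm{can}}_\bullet$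 is the minimizer whose weights have greatest common divisor $1$. Theorem. Let $n\ge 0$, let $\mathfrak h$ be a Cartan subalgebra of $\mathfrak{sl}_{n+1}(k)$, let $\Phi^+$ be a choice of positive roots, and let $\mathfrak n=\bigoplus_{\alpha\in\Phi^+}(\mathfrak{sl}_{n+1})_\alpha$ be the nilradical of the Borel subalgebra $\mathfrak h\oplus\mathfrak n$. Then there are linearly independent $\alpha_1,\dots,\alpha_n$ (the simple roots, suitably numbered) such that $\Phi^+=\{\beta_{i,j} : 1\le i<j\le n+1\}$ with $\beta_{i,j}=\alpha_i+\alpha_{i+1}+\dots+\alpha_{j-1}$, and such that the canonical filtration of $\mathfrak n$ exists, is unique, and is given by $$F(\mathfrak n)^{\mathrm{can}}_m=\bigoplus_{\substack{1\le i<j\le n+1\\ j-i\ge m}}(\mathfrak{sl}_{n+1})_{\beta_{i,j}}\qquad(m\in\mathbb Z).$$ The filtrations that are canonical up to the normalization of the weights are exactly the positive integer rescalings $m\mapsto F(\mathfrak n)^{\mathrm{can}}_{\lceil m/c\rceil}$, $c\ge 1$, of this one. Equivalently, each nonzero vector of the root space of $\beta_{i,j}$ has weight equal to the height $j-i$ of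 $\beta_{i,j}$, i.e. $j-i$ is the largest $m$ such that the vector lies in $F(\mathfrak n)^{\mathrm{can}}_m$. -/

import Mathlib

/-- A filtration of a Lie algebra `L`: a decreasing, bounded sequence of subspaces indexed by `ℤ`
and compatible with the bracket. -/
@[ext]
structure LieFiltration (k L : Type*) [Field k] [LieRing L] [LieAlgebra k L] where
  /-- The `m`-th filtered piece. -/
  piece : ℤ → Submodule k L
  antitone' : Antitone piece
  lie_mem' : ∀ i j : ℤ, ∀ x ∈ piece i, ∀ y ∈ piece j, ⁅x, y⁆ ∈ piece (i + j)
  exists_top' : ∃ a : ℤ, ∀ m ≤ a, piece m = ⊤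
  exists_bot' : ∃ b : ℤ, ∀ m ≥ b, piece m = ⊥

namespace LieFiltration

variable {k L : Type*} [Field k] [LieRing L] [LieAlgebra k L]

/-- The trivial filtration: everything in degrees `≤ 0` and zero in degrees `> 0`. -/
def trivial (k L : Type*) [Field k] [LieRing L] [LieAlgebra k L] : LieFiltration k L where
  piece m := if m ≤ 0 then ⊤ else ⊥
  antitone' := by
    intro i j hij
    by_cases hj : j ≤ 0
    · have hi : i ≤ 0 := by omega
      simp [hi]
    · simp [hj]
  lie_mem' := by
    intro i j x hx y hy
    by_cases hi : i ≤ 0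
    · by_cases hj : j ≤ 0
      · have hij : i + j ≤ 0 := by omega
        simp [hij]
      · have hy0 : y = 0 := by simpa [hj] using hy
        simp [hy0]
    · have hx0 : x = 0 := by simpa [hi] using hx
      simp [hx0]
  exists_top' := ⟨0, fun m hm => by simp [hm]⟩
  exists_bot' := ⟨1, fun m hm => by
    have h : ¬ m ≤ 0 := by omega
    simp [h]⟩

/-- The dimension of the graded piece `F_m / F_{m+1}`. -/
noncomputable def grDim (F : LieFiltration k L) (m : ℤ) : ℕ :=
  Module.finrank k (F.piece m ⧸ (F.piece (m + 1)).submoduleOf (F.piece m))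

/-- The weight `∑ₘ m · dim (F_m / F_{m+1})`; only finitely many terms are nonzero. -/
noncomputable def wt (F : LieFiltration k L) : ℝ :=
  ∑ᶠ m : ℤ, (m : ℝ) * (F.grDim m : ℝ)

/-- The norm `(∑ₘ m² · dim (F_m / F_{m+1}))^{1/2}`. -/
noncomputable def norm (F : LieFiltration k L) : ℝ :=
  Real.sqrt (∑ᶠ m : ℤ, (m : ℝ) ^ 2 * (F.grDim m : ℝ))

/-- The numerical invariant `ν = - wt / norm`. For finite-dimensional `L` the norm vanishes only
for the trivial filtration, and then the value is `0`. -/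
noncomputable def nu (F : LieFiltration k L) : ℝ :=
  - F.wt / F.norm

/-- `F` is the rescaling of `G` in which all weights are multiplied by the positive integer `c`,
i.e. `F_m = G_{⌈m / c⌉}`. -/
def IsRescaling (F G : LieFiltration k L) (c : ℕ) : Prop :=
  0 < c ∧ ∀ m : ℤ, F.piece m = G.piece ⌈(m : ℚ) / (c : ℚ)⌉

/-- `F` is indivisible: its weights, i.e. the `m` with `F_m ≠ F_{m+1}`, have no common divisor
other than `1`. -/
def IsIndivisible (F : LieFiltration k L) : Prop :=
  ∀ d : ℕ, (∀ m : ℤ, F.piece m ≠ F.piece (m + 1) → (d : ℤ) ∣ m) → d = 1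

end LieFiltration

/-- A (finite-dimensional) Lie algebra is semistable if `- wt F ≥ 0` for all filtrations `F`. -/
def IsSemistableLie (k L : Type*) [Field k] [LieRing L] [LieAlgebra k L] : Prop :=
  ∀ F : LieFiltration k L, 0 ≤ - F.wt

namespace LieFiltration

variable {k L : Type*} [Field k] [LieRing L] [LieAlgebra k L]

/-- `F` is a canonical filtration up to positive rescaling of its weights: the trivial filtration
if `L` is semistable, and a minimizer of `ν` among all filtrations if `L` is unstable. -/
def IsCanonicalUpToScaling (F : LieFiltration k L) : Prop :=
  (IsSemistableLie k L → F = trivial k L) ∧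
  (¬ IsSemistableLie k L → ∀ F' : LieFiltration k L, F.nu ≤ F'.nu)

/-- `F` is the canonical filtration: the trivial filtration if `L` is semistable, and the minimizer
of `ν`, normalised to have coprime integer weights (`ν` is invariant under rescaling), if `L` is
unstable. -/
def IsCanonical (F : LieFiltration k L) : Prop :=
  F.IsCanonicalUpToScaling ∧ (¬ IsSemistableLie k L → F.IsIndivisible)

end LieFiltration

section Borel

variable {k L : Type*} [Field k] [LieRing L] [LieAlgebra k L]
  (H : LieSubalgebra k L) [H.IsCartanSubalgebra]

/-- `α` is a root of `L` with respect to the Cartan subalgebra `H`. -/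
def IsRootOf (α : H → k) : Prop :=
  α ≠ 0 ∧ LieAlgebra.rootSpace H α ≠ ⊥

/-- A choice of positive roots: for each root `α` exactly one of `α`, `-α` is chosen, and
every root which is a sum of two chosen roots is chosen. -/
structure IsPositiveSystem (P : Set (H → k)) : Prop where
  isRoot : ∀ α ∈ P, IsRootOf H α
  mem_or_neg_mem : ∀ α, IsRootOf H α → α ∈ P ∨ -α ∈ P
  neg_notMem : ∀ α ∈ P, -α ∉ P
  add_mem : ∀ α ∈ P, ∀ β ∈ P, IsRootOf H (α + β) → α + β ∈ P

/-- The subalgebra `𝔫 = ⨁_{α ∈ P} L_α` for a choice `P` of positive roots: the nilradical of the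
Borel subalgebra `H ⊕ 𝔫`. -/
def borelNilradical (P : Set (H → k)) (hP : IsPositiveSystem H P) : LieSubalgebra k L where
  toSubmodule := ⨆ α ∈ P, (LieAlgebra.rootSpace H α).toSubmodule
  lie_mem' := by
    intro x y hx hy
    have key : ∀ α ∈ P, ∀ β ∈ P, ∀ a ∈ LieAlgebra.rootSpace H α, ∀ b ∈ LieAlgebra.rootSpace H β,
        ⁅a, b⁆ ∈ ⨆ γ ∈ P, (LieAlgebra.rootSpace H γ).toSubmodule := by
      intro α hα β hβ a ha b hb
      have hab : ⁅a, b⁆ ∈ LieAlgebra.rootSpace H (α + β) :=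
        LieAlgebra.lie_mem_genWeightSpace_of_mem_genWeightSpace ha hb
      by_cases hr : IsRootOf H (α + β)
      · exact Submodule.mem_iSup_of_mem (α + β)
          (Submodule.mem_iSup_of_mem (hP.add_mem α hα β hβ hr) hab)
      · have h0 : α + β ≠ 0 := by
          intro h0
          apply hP.neg_notMem α hα
          rwa [neg_eq_of_add_eq_zero_right h0]
        have hbot : LieAlgebra.rootSpace H (α + β) = ⊥ := by
          by_contra hne
          exact hr ⟨h0, hne⟩
        rw [hbot, LieSubmodule.mem_bot] at hab
        rw [hab]
        exact Submodule.zero_mem _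
    replace hx : x ∈ ⨆ α ∈ P, (LieAlgebra.rootSpace H α).toSubmodule := hx
    replace hy : y ∈ ⨆ α ∈ P, (LieAlgebra.rootSpace H α).toSubmodule := hy
    change ⁅x, y⁆ ∈ ⨆ α ∈ P, (LieAlgebra.rootSpace H α).toSubmodule
    rw [iSup_subtype'] at hx hy
    induction hx using Submodule.iSup_induction' with
    | mem α a ha =>
      induction hy using Submodule.iSup_induction' with
      | mem β b hb => exact key α α.2 β β.2 a ha b hb
      | zero => simp
      | add b b' _ _ hb hb' => rw [lie_add]; exact Submodule.add_mem _ hb hb'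
    | zero => simp
    | add a a' _ _ ha ha' => rw [add_lie]; exact Submodule.add_mem _ ha ha'

end Borel

/-- `β_{i,j} = α_i + α_{i+1} + ⋯ + α_{j-1}` (indices starting at `0`). -/
def consecutiveSum {M : Type*} [AddCommMonoid M] {n : ℕ} (α : Fin n → M) (i j : Fin (n + 1)) : M :=
  ∑ l ∈ Finset.univ.filter (fun l : Fin n => (i : ℕ) ≤ (l : ℕ) ∧ (l : ℕ) < (j : ℕ)), α l

/-! In suitable coordinates the Cartan subalgebra consists of the traceless diagonal matrices, and
the positive system is a total order on the coordinates. So the nilradical is the algebra of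
strictly upper triangular `N × N` matrices, `N = n + 1`, and the theorem becomes an extremal problem
there.

Order the positions above the diagonal by height `h(i,j) = j - i`, then by row. For a filtration
`F`, let `w(β)` be the largest degree of an element whose first nonzero entry is at `β`. By an
echelon-form count, `wt F = ∑ w` and `‖F‖² = ∑ w²`. Leading positions multiply under the bracket, so
`w(i,j) + w(j,l) ≤ w(i,l)` (`isLeadingAt_lie`). Summing this over all `i < j < l` and counting how
often each pair occurs gives `N ∑ w ≤ 2 ∑ w h`, with equality for `w = h` (`sum_le_sum_mul_height`,
`sum_height`). By Cauchy-Schwarz, `∑ w / ‖w‖ ≤ (2/N) ‖h‖ = ∑ h / ‖h‖`, which says `ν(F) ≥ ν` of the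
height filtration.

Equality forces `w = c h`, where `c` is the weight of a position of height one and hence a positive
integer. Then `F_m` lies in the rescaled height filtration and has the same dimension, so the two
agree (`nu_min`). No conjugation of `F` into a standard position is needed. -/

/-! ### Leading positions and dimensions of subspaces -/

/-- `β` is the leading position of `x`: the coordinate of `x` at `β` is nonzero, and those at
positions with smaller key vanish. -/
def IsLeadingAt {k V I O : Type*} [Field k] [AddCommGroup V] [Module k V] [LT O]
    (e : V ≃ₗ[k] (I → k)) (κ : I → O) (x : V) (β : I) : Prop :=
  e x β ≠ 0 ∧ ∀ γ, κ γ < κ β → e x γ = 0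

theorem exists_isLeadingAt {k V I O : Type*} [Field k] [AddCommGroup V] [Module k V] [Finite I]
    [LinearOrder O] (e : V ≃ₗ[k] (I → k)) (κ : I → O) {x : V} (hx : x ≠ 0) :
    ∃ β, IsLeadingAt e κ x β := by
  classical
  have hne : {β | e x β ≠ 0}.Nonempty := by
    by_contra h
    rw [Set.not_nonempty_iff_eq_empty, Set.eq_empty_iff_forall_notMem] at h
    apply hx
    apply e.injective
    ext β
    simpa using h β
  obtain ⟨β, hβ, hmin⟩ := Set.exists_min_image {β | e x β ≠ 0} κ (Set.toFinite _) hne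
  refine ⟨β, hβ, fun γ hγ => ?_⟩
  by_contra h
  exact absurd (hmin γ h) (not_le.mpr hγ)

/-- The dimension of a subspace is the number of leading positions of its elements. -/
theorem finrank_eq_card_leading {k V I O : Type*} [Field k] [AddCommGroup V] [Module k V]
    [Fintype I] [LinearOrder O] (e : V ≃ₗ[k] (I → k)) (κ : I → O) (hκ : Function.Injective κ)
    (W : Submodule k V) (S : Finset I) (hS : ∀ β, β ∈ S ↔ ∃ x ∈ W, IsLeadingAt e κ x β) :
    Module.finrank k W = S.card := by
  classical
  have : FiniteDimensional k V := e.symm.finiteDimensional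
  apply le_antisymm
  -- Restricting to the coordinates in `S` is injective on `W`, because the leading coordinate of a
  -- nonzero element survives.
  · let f : W →ₗ[k] (S → k) :=
      LinearMap.funLeft k k (Subtype.val : S → I) ∘ₗ e.toLinearMap ∘ₗ W.subtype
    have hf : Function.Injective f := by
      rw [← LinearMap.ker_eq_bot, LinearMap.ker_eq_bot']
      intro x hx
      by_contra hne
      obtain ⟨β, hβ⟩ := exists_isLeadingAt e κ (x := (x : V)) (by simpa using hne)
      have hmem : β ∈ S := (hS β).2 ⟨x, x.2, hβ⟩
      exact hβ.1 (congrFun hx ⟨β, hmem⟩)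
    simpa using LinearMap.finrank_le_finrank_of_injective hf
  · have h := fun β : S => (hS β).1 β.2
    choose x hxW hx using h
    have hli : LinearIndependent k (fun β : S => (⟨x β, hxW β⟩ : W)) := by
      rw [Fintype.linearIndependent_iff]
      intro g hg
      by_contra! hne
      -- Echelon form: in a linear relation, the earliest position with nonzero coefficient receives
      -- no contribution from the other terms.
      obtain ⟨β, hβ, hmin⟩ := Set.exists_min_image {β : S | g β ≠ 0} (fun β => κ β)
        (Set.toFinite _) hne
      have h0 : ∑ γ : S, g γ * e (x γ) β = 0 := by
        have := congrArg (fun y : W => e (y : V) β) hg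
        simpa using this
      rw [Finset.sum_eq_single β] at h0
      · exact mul_ne_zero hβ (hx β).1 h0
      · intro γ _ hγ
        by_cases hgγ : g γ = 0
        · simp [hgγ]
        · have hle := hmin γ hgγ
          have hlt : κ β < κ γ := lt_of_le_of_ne hle
            (fun h => hγ (Subtype.ext (hκ h.symm)))
          rw [(hx γ).2 β hlt, mul_zero]
      · simp
    simpa using hli.fintype_card_le_finrank

/-! ### Weight and norm of a filtration through leading weights -/

namespace LieFiltration

variable {k L : Type*} [Field k] [LieRing L] [LieAlgebra k L]

theorem grDim_add_finrank [FiniteDimensional k L] (F : LieFiltration k L) (m : ℤ) :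
    F.grDim m + Module.finrank k (F.piece (m + 1)) = Module.finrank k (F.piece m) := by
  have hle : F.piece (m + 1) ≤ F.piece m := F.antitone' (by omega)
  rw [← Submodule.finrank_quotient_add_finrank ((F.piece (m + 1)).submoduleOf (F.piece m)),
    (Submodule.submoduleOfEquivOfLe hle).finrank_eq]
  rfl

theorem grDim_eq_card [FiniteDimensional k L] {I : Type*} [Fintype I] (F : LieFiltration k L)
    (w : I → ℤ)
    (hw : ∀ m, Module.finrank k (F.piece m) = (Finset.univ.filter fun β => m ≤ w β).card) (m : ℤ) :
    F.grDim m = (Finset.univ.filter fun β => w β = m).card := by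
  have h := F.grDim_add_finrank m
  rw [hw, hw] at h
  have hd : (Finset.univ.filter fun β => m ≤ w β).card =
      (Finset.univ.filter fun β => w β = m).card +
        (Finset.univ.filter fun β => m + 1 ≤ w β).card := by
    classical
    rw [← Finset.card_union_of_disjoint]
    · congr 1
      ext β
      simp only [Finset.mem_filter, Finset.mem_univ, true_and, Finset.mem_union]
      omega
    · rw [Finset.disjoint_filter]
      intro β _ h1 h2
      omega
  omega

/-- The dimensions of the pieces determine the multiset of weights, so any `w` counting them
correctly computes both `wt` and `norm`. -/
theorem finsum_mul_grDim [FiniteDimensional k L] {I : Type*} [Fintype I] (F : LieFiltration k L)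
    (w : I → ℤ)
    (hw : ∀ m, Module.finrank k (F.piece m) = (Finset.univ.filter fun β => m ≤ w β).card)
    (f : ℤ → ℝ) : ∑ᶠ m : ℤ, f m * (F.grDim m : ℝ) = ∑ β, f (w β) := by
  classical
  rw [finsum_eq_sum_of_support_subset (s := Finset.univ.image w)]
  · rw [← Finset.sum_fiberwise_of_maps_to (t := Finset.univ.image w) (g := w)
      (fun i _ => Finset.mem_image_of_mem w (Finset.mem_univ i))]
    refine Finset.sum_congr rfl fun m _ => ?_
    rw [F.grDim_eq_card w hw, Finset.sum_congr rfl (g := fun _ => f m)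
      (fun β hβ => by rw [(Finset.mem_filter.1 hβ).2]), Finset.sum_const, nsmul_eq_mul, mul_comm]
  · intro m hm
    rw [Function.mem_support] at hm
    by_contra hnot
    apply hm
    rw [F.grDim_eq_card w hw, Finset.card_eq_zero.2, Nat.cast_zero, mul_zero]
    rw [Finset.filter_eq_empty_iff]
    intro β _ hβ
    exact hnot (by simp [← hβ])

theorem wt_eq_sum [FiniteDimensional k L] {I : Type*} [Fintype I] (F : LieFiltration k L)
    (w : I → ℤ)
    (hw : ∀ m, Module.finrank k (F.piece m) = (Finset.univ.filter fun β => m ≤ w β).card) :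
    F.wt = ∑ β, (w β : ℝ) :=
  F.finsum_mul_grDim w hw fun m => (m : ℝ)

theorem norm_eq_sqrt_sum [FiniteDimensional k L] {I : Type*} [Fintype I] (F : LieFiltration k L)
    (w : I → ℤ)
    (hw : ∀ m, Module.finrank k (F.piece m) = (Finset.univ.filter fun β => m ≤ w β).card) :
    F.norm = Real.sqrt (∑ β, (w β : ℝ) ^ 2) := by
  rw [LieFiltration.norm, F.finsum_mul_grDim w hw fun m => (m : ℝ) ^ 2]

/-- Every filtration has leading weights: `w β` is the largest degree of an element with leading
position `β`. -/
theorem exists_leadingWeight {I O : Type*} [Fintype I] [LinearOrder O]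
    (F : LieFiltration k L) (e : L ≃ₗ[k] (I → k)) (κ : I → O) (hκ : Function.Injective κ) :
    ∃ w : I → ℤ, (∀ m β, (∃ x ∈ F.piece m, IsLeadingAt e κ x β) ↔ m ≤ w β) ∧
      ∀ m, Module.finrank k (F.piece m) = (Finset.univ.filter fun β => m ≤ w β).card := by
  classical
  have key : ∀ β, ∃ c : ℤ, ∀ m, (∃ x ∈ F.piece m, IsLeadingAt e κ x β) ↔ m ≤ c := by
    intro β
    obtain ⟨a, ha⟩ := F.exists_top'
    obtain ⟨b, hb⟩ := F.exists_bot'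
    -- The degrees are bounded above since high pieces vanish, and some degree occurs since a low
    -- piece contains the unit vector at `β`.
    obtain ⟨c, hc, hmax⟩ := Int.exists_greatest_of_bdd
      (P := fun m => ∃ x ∈ F.piece m, IsLeadingAt e κ x β) ⟨b, fun z hz => by
        by_contra! hlt
        obtain ⟨x, hx, hx'⟩ := hz
        rw [hb z hlt.le, Submodule.mem_bot] at hx
        exact hx'.1 (by simp [hx])⟩ ⟨a, e.symm (Pi.single β 1), by simp [ha a le_rfl], by simp,
          fun γ hγ => by
            have hne : γ ≠ β := fun h => by simp [h] at hγ
            simp [hne]⟩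
    refine ⟨c, fun m => ⟨fun h => hmax m h, fun h => ?_⟩⟩
    obtain ⟨x, hx, hx'⟩ := hc
    exact ⟨x, F.antitone' h hx, hx'⟩
  choose w hw using key
  refine ⟨w, fun m β => hw β m, fun m => ?_⟩
  exact finrank_eq_card_leading e κ hκ (F.piece m) _ fun β => by simp [hw]

end LieFiltration

/-! ### Superadditive functions on positions above the diagonal -/

/-- The positions strictly above the diagonal of an `N × N` matrix. -/
abbrev UpperPair (N : ℕ) : Type := {p : Fin N × Fin N // p.1 < p.2}

namespace UpperPair

variable {N : ℕ}

/-- The height `j - i` of the position `(i, j)`. -/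
def height (p : UpperPair N) : ℤ := (p.1.2 : ℤ) - (p.1.1 : ℤ)

theorem height_pos (p : UpperPair N) : 0 < p.height := by
  have := p.2
  simp only [height, Fin.lt_def] at this ⊢
  omega

theorem sum_eq (w : Fin N → Fin N → ℤ) :
    ∑ p : UpperPair N, w p.1.1 p.1.2 = ∑ i, ∑ j, if i < j then w i j else 0 := by
  have h := Fintype.sum_prod_type' (fun i j : Fin N => if i < j then w i j else 0)
  rw [← h, ← Finset.sum_filter]
  exact (Finset.sum_subtype _ (by simp) fun p : Fin N × Fin N => w p.1 p.2).symm

/-- With indices from `0`, a pair `(i, j)` is the outer pair of `j - i - 1` triples, the left pair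
of `N - 1 - j` and the right pair of `i`. The signed count is `2 (j - i) - N`. -/
theorem sum_triples (u : Fin N → Fin N → ℤ) :
    (∑ i, ∑ j, ∑ l, if i < j ∧ j < l then u i l - u i j - u j l else 0) =
      ∑ i, ∑ j, if i < j then u i j * (2 * ((j : ℤ) - i) - N) else 0 := by
  have h1 : (∑ i, ∑ j, ∑ l, if i < j ∧ j < l then u i l else 0) =
      ∑ i, ∑ l : Fin N, if i < l then u i l * ((l : ℤ) - i - 1) else 0 := by
    refine Finset.sum_congr rfl fun i _ => ?_
    rw [Finset.sum_comm]
    refine Finset.sum_congr rfl fun l _ => ?_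
    rw [← Finset.sum_filter, Finset.sum_const, nsmul_eq_mul,
      show (Finset.univ.filter fun j => i < j ∧ j < l) = Finset.Ioo i l by ext; simp, Fin.card_Ioo]
    split_ifs with h
    · rw [Fin.lt_def] at h
      rw [mul_comm, Nat.sub_sub, Nat.cast_sub (by omega)]
      push_cast
      ring
    · rw [Fin.lt_def] at h
      rw [show (l : ℕ) - i - 1 = 0 by omega]
      simp
  have h2 : (∑ i, ∑ j, ∑ l, if i < j ∧ j < l then u i j else 0) =
      ∑ i, ∑ j : Fin N, if i < j then u i j * ((N : ℤ) - 1 - j) else 0 := by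
    refine Finset.sum_congr rfl fun i _ => Finset.sum_congr rfl fun j _ => ?_
    split_ifs with h
    · simp only [h, true_and]
      rw [← Finset.sum_filter, Finset.sum_const, nsmul_eq_mul,
        show (Finset.univ.filter fun l => j < l) = Finset.Ioi j by ext; simp, Fin.card_Ioi,
        mul_comm, Nat.sub_sub, Nat.cast_sub (by omega)]
      push_cast
      ring
    · simp [h]
  have h3 : (∑ i, ∑ j, ∑ l, if i < j ∧ j < l then u j l else 0) =
      ∑ j, ∑ l : Fin N, if j < l then u j l * (j : ℤ) else 0 := by
    rw [Finset.sum_comm]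
    refine Finset.sum_congr rfl fun j _ => ?_
    rw [Finset.sum_comm]
    refine Finset.sum_congr rfl fun l _ => ?_
    split_ifs with h
    · simp only [h, and_true]
      rw [← Finset.sum_filter, Finset.sum_const, nsmul_eq_mul,
        show (Finset.univ.filter fun i => i < j) = Finset.Iio j by ext; simp, Fin.card_Iio,
        mul_comm]
    · simp [h]
  have hsplit : ∀ i j l : Fin N, (if i < j ∧ j < l then u i l - u i j - u j l else 0) =
      (if i < j ∧ j < l then u i l else 0) - (if i < j ∧ j < l then u i j else 0) -
        (if i < j ∧ j < l then u j l else 0) := by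
    intro i j l
    split_ifs <;> simp
  simp only [hsplit, Finset.sum_sub_distrib]
  rw [h1, h2, h3]
  simp only [← Finset.sum_sub_distrib]
  refine Finset.sum_congr rfl fun i _ => Finset.sum_congr rfl fun j _ => ?_
  split_ifs
  · ring
  · simp

/-- Superadditive functions on the positions above the diagonal correlate with the height. -/
theorem sum_le_sum_mul_height (w : UpperPair N → ℤ)
    (hw : ∀ (i j l : Fin N) (hij : i < j) (hjl : j < l),
      w ⟨(i, j), hij⟩ + w ⟨(j, l), hjl⟩ ≤ w ⟨(i, l), hij.trans hjl⟩) :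
    N * ∑ p, w p ≤ 2 * ∑ p, w p * p.height := by
  set u : Fin N → Fin N → ℤ := fun i j => if h : i < j then w ⟨(i, j), h⟩ else 0 with hu
  have hsum : ∑ p, w p * (2 * p.height - N) =
      ∑ p : UpperPair N, u p.1.1 p.1.2 * (2 * ((p.1.2 : ℤ) - p.1.1) - N) := by
    refine Finset.sum_congr rfl fun p _ => ?_
    have := p.2
    simp [hu, this, height]
  have h0 : 0 ≤ ∑ p, w p * (2 * p.height - N) := by
    rw [hsum, sum_eq fun i j => u i j * (2 * ((j : ℤ) - i) - N), ← sum_triples]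
    refine Finset.sum_nonneg fun i _ => Finset.sum_nonneg fun j _ => Finset.sum_nonneg fun l _ => ?_
    split_ifs with h
    · have := hw i j l h.1 h.2
      simp only [hu, h.1, h.2, h.1.trans h.2, dif_pos]
      linarith
    · exact le_rfl
  have h1 : ∑ p, w p * (2 * p.height - N) = 2 * ∑ p, w p * p.height - N * ∑ p, w p := by
    rw [Finset.mul_sum, Finset.mul_sum, ← Finset.sum_sub_distrib]
    exact Finset.sum_congr rfl fun p _ => by ring
  linarith

/-- Height is additive, so both it and its negative are superadditive, and the two inequalities
combine to an equality. -/
theorem sum_height : N * ∑ p : UpperPair N, p.height = 2 * ∑ p : UpperPair N, p.height ^ 2 := by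
  have h1 := sum_le_sum_mul_height (N := N) height fun i j l _ _ => by simp [height]
  have h2 := sum_le_sum_mul_height (N := N) (fun p => -p.height) fun i j l _ _ => by simp [height]
  simp only [Finset.sum_neg_distrib, neg_mul, ← sq] at h1 h2
  linarith

end UpperPair

/-! ### The Cauchy-Schwarz step -/

/-- If `A / ‖w‖ ≤ B / ‖h‖` could only be violated through the Cauchy-Schwarz inequality, it holds,
with equality only for `w` proportional to `h`. -/
theorem sum_div_sqrt_le {I : Type*} [Fintype I] (w h : I → ℝ) (c : ℝ) (hc : 0 < c)
    (hh : ∑ p, h p = c * ∑ p, h p ^ 2) (hw : ∑ p, w p ≤ c * ∑ p, w p * h p)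
    (hpos : 0 < ∑ p, h p ^ 2) :
    (∑ p, w p) / √(∑ p, w p ^ 2) ≤ (∑ p, h p) / √(∑ p, h p ^ 2) ∧
    ((∑ p, h p) / √(∑ p, h p ^ 2) ≤ (∑ p, w p) / √(∑ p, w p ^ 2) →
      ∃ t : ℝ, 0 < t ∧ ∀ p, w p = t * h p) := by
  have hCS : ∑ p, w p * h p ≤ √(∑ p, w p ^ 2) * √(∑ p, h p ^ 2) :=
    Real.sum_mul_le_sqrt_mul_sqrt _ _ _
  set A := ∑ p, w p
  set D := ∑ p, w p * h p with hD
  set S := ∑ p, w p ^ 2 with hS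
  set Q := ∑ p, h p ^ 2 with hQ
  have hs : 0 ≤ √S := Real.sqrt_nonneg _
  have hq : 0 < √Q := Real.sqrt_pos.2 hpos
  have hqq : √Q * √Q = Q := Real.mul_self_sqrt hpos.le
  have hS0 : 0 ≤ S := Finset.sum_nonneg fun p _ => sq_nonneg _
  have hss : √S * √S = S := Real.mul_self_sqrt hS0
  have hB : (∑ p, h p) / √Q = c * √Q := by
    rw [hh, div_eq_iff hq.ne', mul_assoc, hqq]
  rw [hB]
  constructor
  -- If `w = 0`, the quotient is `0` by the convention for division by zero.
  · rcases hs.eq_or_lt with h0 | h0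
    · rw [← h0, div_zero]
      positivity
    · rw [div_le_iff₀ h0]
      calc A ≤ c * D := hw
        _ ≤ c * (√S * √Q) := by gcongr
        _ = c * √Q * √S := by ring
  · intro hle
    have h0 : 0 < √S := by
      rcases hs.eq_or_lt with h0 | h0
      · rw [← h0, div_zero] at hle
        exact absurd hle (not_le.2 (by positivity))
      · exact h0
    rw [le_div_iff₀ h0] at hle
    have hDge : √S * √Q ≤ D := by
      have : c * (√S * √Q) ≤ c * D := by linarith
      exact le_of_mul_le_mul_left this hc
    have hDeq : D = √S * √Q := le_antisymm hCS hDge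
    refine ⟨√S / √Q, by positivity, ?_⟩
    -- Equality in Cauchy-Schwarz: the squared distance from `w` to its multiple of `h` of the same
    -- norm expands to `0`.
    have hzero : ∑ p, (w p - √S / √Q * h p) ^ 2 = 0 := by
      have : ∑ p, (w p - √S / √Q * h p) ^ 2 = S - 2 * (√S / √Q) * D + (√S / √Q) ^ 2 * Q := by
        rw [hS, hD, hQ, Finset.mul_sum, Finset.mul_sum, ← Finset.sum_sub_distrib,
          ← Finset.sum_add_distrib]
        exact Finset.sum_congr rfl fun p _ => by ring
      rw [this, hDeq]
      field_simp
      nlinarith [hqq, hss]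
    intro p
    rw [Finset.sum_eq_zero_iff_of_nonneg fun p _ => sq_nonneg _] at hzero
    have := hzero p (Finset.mem_univ p)
    rw [sq_eq_zero_iff] at this
    linarith

/-! ### Filtrations of the strictly upper triangular matrices -/

/-- `e` identifies the Lie algebra `L` with the strictly upper triangular `N × N` matrices. -/
structure IsStrictUpperModel {k L : Type*} [Field k] [LieRing L] [LieAlgebra k L] {N : ℕ}
    (e : L →ₗ[k] Matrix (Fin N) (Fin N) k) : Prop where
  injective : Function.Injective e
  eq_zero : ∀ x i j, j ≤ i → e x i j = 0
  exists_eq : ∀ A : Matrix (Fin N) (Fin N) k, (∀ i j, j ≤ i → A i j = 0) → ∃ x, e x = A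
  map_lie : ∀ x y, e ⁅x, y⁆ = e x * e y - e y * e x

namespace IsStrictUpperModel

open UpperPair

/-- Positions above the diagonal, ordered by height and then by row. -/
def _root_.UpperPair.key {N : ℕ} (p : UpperPair N) : ℤ ×ₗ ℕ := toLex (p.height, (p.1.1 : ℕ))

theorem _root_.UpperPair.key_lt_key {N : ℕ} (p q : UpperPair N) :
    p.key < q.key ↔ p.height < q.height ∨ p.height = q.height ∧ (p.1.1 : ℕ) < q.1.1 := by
  simp [key, Prod.Lex.toLex_lt_toLex]

theorem _root_.UpperPair.key_injective {N : ℕ} : Function.Injective (key (N := N)) := by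
  rintro ⟨⟨i, j⟩, h⟩ ⟨⟨i', j'⟩, h'⟩ hk
  simp only [key, height, EmbeddingLike.apply_eq_iff_eq, Prod.mk.injEq] at hk
  simp only [Subtype.mk.injEq, Prod.mk.injEq, Fin.ext_iff]
  omega

variable {k L : Type*} [Field k] [LieRing L] [LieAlgebra k L] {N : ℕ}
  {e : L →ₗ[k] Matrix (Fin N) (Fin N) k} (he : IsStrictUpperModel e)

theorem coord_bijective (he : IsStrictUpperModel e) :
    Function.Bijective (LinearMap.pi fun p : UpperPair N =>
      (Matrix.entryLinearMap k k p.1.1 p.1.2 : Matrix (Fin N) (Fin N) k →ₗ[k] k) ∘ₗ e) := by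
  constructor
  · intro x y hxy
    apply he.injective
    ext i j
    by_cases h : i < j
    · exact congrFun hxy ⟨(i, j), h⟩
    · rw [he.eq_zero x i j (not_lt.1 h), he.eq_zero y i j (not_lt.1 h)]
  · intro f
    obtain ⟨x, hx⟩ := he.exists_eq (fun i j => if h : i < j then f ⟨(i, j), h⟩ else 0)
      (fun i j h => dif_neg (not_lt.2 h))
    refine ⟨x, ?_⟩
    ext p
    change e x p.1.1 p.1.2 = f p
    rw [hx]
    exact dif_pos p.2

/-- The coordinates above the diagonal. -/
noncomputable def coord : L ≃ₗ[k] (UpperPair N → k) :=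
  LinearEquiv.ofBijective _ he.coord_bijective

theorem coord_apply (x : L) (p : UpperPair N) : he.coord x p = e x p.1.1 p.1.2 := rfl

theorem finiteDimensional (he : IsStrictUpperModel e) : FiniteDimensional k L := he.coord.symm.finiteDimensional

/-- Heights add under matrix multiplication, so nothing in `xy` or `yx` has height below `l - i`. At
the minimal height the row tie-break matters: entries of `xy` lie in rows `≥ i`, and entries of `yx`
in rows `≥ j > i`. Hence `yx` cannot cancel the product of leading coefficients at `(i, l)`. -/
theorem isLeadingAt_lie {x y : L} {i j l : Fin N} (hij : i < j) (hjl : j < l)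
    (hx : IsLeadingAt he.coord key x ⟨(i, j), hij⟩)
    (hy : IsLeadingAt he.coord key y ⟨(j, l), hjl⟩) :
    IsLeadingAt he.coord key ⁅x, y⁆ ⟨(i, l), hij.trans hjl⟩ := by
  have hx0 : ∀ p q : Fin N, e x p q ≠ 0 → p < q ∧ ((j : ℤ) - i < (q : ℤ) - p ∨
      (j : ℤ) - i = (q : ℤ) - p ∧ (i : ℕ) ≤ p) := by
    intro p q h
    have hpq : p < q := by
      by_contra hn
      exact h (he.eq_zero x p q (not_lt.1 hn))
    refine ⟨hpq, ?_⟩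
    by_contra hn
    refine h (hx.2 ⟨(p, q), hpq⟩ ?_)
    rw [key_lt_key]
    simp only [height]
    omega
  have hy0 : ∀ p q : Fin N, e y p q ≠ 0 → p < q ∧ ((l : ℤ) - j < (q : ℤ) - p ∨
      (l : ℤ) - j = (q : ℤ) - p ∧ (j : ℕ) ≤ p) := by
    intro p q h
    have hpq : p < q := by
      by_contra hn
      exact h (he.eq_zero y p q (not_lt.1 hn))
    refine ⟨hpq, ?_⟩
    by_contra hn
    refine h (hy.2 ⟨(p, q), hpq⟩ ?_)
    rw [key_lt_key]
    simp only [height]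
    omega
  rw [Fin.lt_def] at hij hjl
  constructor
  · rw [coord_apply, he.map_lie, Matrix.sub_apply, Matrix.mul_apply, Matrix.mul_apply]
    simp only
    rw [Finset.sum_eq_single j, Finset.sum_eq_zero, sub_zero]
    · exact mul_ne_zero hx.1 hy.1
    · intro r _
      by_contra h
      obtain ⟨_, h1⟩ := hy0 _ _ (left_ne_zero_of_mul h)
      obtain ⟨_, h2⟩ := hx0 _ _ (right_ne_zero_of_mul h)
      omega
    · intro r _ hr
      by_contra h
      obtain ⟨_, h1⟩ := hx0 _ _ (left_ne_zero_of_mul h)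
      obtain ⟨_, h2⟩ := hy0 _ _ (right_ne_zero_of_mul h)
      apply hr
      rw [Fin.ext_iff]
      omega
    · simp
  · intro p hp
    rw [key_lt_key] at hp
    simp only [height] at hp
    rw [coord_apply, he.map_lie, Matrix.sub_apply, Matrix.mul_apply, Matrix.mul_apply,
      Finset.sum_eq_zero, Finset.sum_eq_zero, sub_zero]
    · intro r _
      by_contra h
      obtain ⟨_, h1⟩ := hy0 _ _ (left_ne_zero_of_mul h)
      obtain ⟨_, h2⟩ := hx0 _ _ (right_ne_zero_of_mul h)
      omega
    · intro r _
      by_contra h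
      obtain ⟨_, h1⟩ := hx0 _ _ (left_ne_zero_of_mul h)
      obtain ⟨_, h2⟩ := hy0 _ _ (right_ne_zero_of_mul h)
      omega

/-- The filtration by height. -/
def heightFiltration : LieFiltration k L where
  piece m :=
    { carrier := {x | ∀ i j : Fin N, (j : ℤ) - i < m → e x i j = 0}
      add_mem' := fun hx hy i j h => by
        rw [map_add, Matrix.add_apply, hx i j h, hy i j h, add_zero]
      zero_mem' := fun i j _ => by simp
      smul_mem' := fun c x hx i j h => by
        rw [map_smul, Matrix.smul_apply, hx i j h, smul_zero] }
  antitone' := fun a b hab x hx i j h => hx i j (by omega)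
  lie_mem' := by
    intro a b x hx y hy i j h
    rw [he.map_lie, Matrix.sub_apply, Matrix.mul_apply, Matrix.mul_apply, Finset.sum_eq_zero,
      Finset.sum_eq_zero, sub_zero]
    · intro r _
      by_contra hne
      have h1 := mt (hy i r) (left_ne_zero_of_mul hne)
      have h2 := mt (hx r j) (right_ne_zero_of_mul hne)
      omega
    · intro r _
      by_contra hne
      have h1 := mt (hx i r) (left_ne_zero_of_mul hne)
      have h2 := mt (hy r j) (right_ne_zero_of_mul hne)
      omega
  exists_top' := ⟨0, fun m hm => by
    rw [eq_top_iff]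
    intro x _ i j h
    refine he.eq_zero x i j ?_
    rw [Fin.le_def]
    omega⟩
  exists_bot' := ⟨N, fun m hm => by
    rw [eq_bot_iff]
    intro x hx
    rw [Submodule.mem_bot]
    apply he.injective
    ext i j
    rw [hx i j (by omega)]
    simp⟩

theorem mem_heightFiltration (m : ℤ) (x : L) :
    x ∈ he.heightFiltration.piece m ↔ ∀ i j : Fin N, (j : ℤ) - i < m → e x i j = 0 := Iff.rfl

theorem mem_heightFiltration' (m : ℤ) (x : L) :
    x ∈ he.heightFiltration.piece m ↔ ∀ p : UpperPair N, p.height < m → he.coord x p = 0 := by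
  rw [mem_heightFiltration]
  constructor
  · exact fun h p hp => h p.1.1 p.1.2 hp
  · intro h i j hij
    by_cases hlt : i < j
    · exact h ⟨(i, j), hlt⟩ hij
    · exact he.eq_zero x i j (not_lt.1 hlt)

theorem finrank_heightFiltration (m : ℤ) :
    Module.finrank k (he.heightFiltration.piece m) =
      (Finset.univ.filter fun p : UpperPair N => m ≤ p.height).card := by
  classical
  refine finrank_eq_card_leading he.coord key key_injective _ _ fun β => ?_
  simp only [Finset.mem_filter, Finset.mem_univ, true_and]
  constructor
  · intro h
    refine ⟨he.coord.symm (Pi.single β 1), ?_, by simp, fun γ hγ => ?_⟩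
    · rw [mem_heightFiltration']
      intro p hp
      have hne : p ≠ β := by
        rintro rfl
        omega
      simp [hne]
    · have hne : γ ≠ β := fun h => by simp [h] at hγ
      simp [hne]
  · rintro ⟨x, hx, hlead⟩
    by_contra h
    exact hlead.1 ((he.mem_heightFiltration' m x).1 hx β (not_le.1 h))

/-- Turns the rescaling `⌈m / c⌉` into multiplication of the weights by `c`. -/
theorem ceil_le_height (m : ℤ) {c : ℕ} (hc : 0 < c) (h : ℤ) :
    ⌈(m : ℚ) / (c : ℚ)⌉ ≤ h ↔ m ≤ c * h := by
  rw [Int.ceil_le, div_le_iff₀ (by exact_mod_cast hc)]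
  norm_cast
  rw [mul_comm]

theorem finrank_of_isRescaling {F : LieFiltration k L} {c : ℕ}
    (hF : F.IsRescaling he.heightFiltration c) (m : ℤ) :
    Module.finrank k (F.piece m) =
      (Finset.univ.filter fun p : UpperPair N => m ≤ c * p.height).card := by
  rw [hF.2, finrank_heightFiltration]
  simp only [ceil_le_height m hF.1]

theorem nu_heightFiltration : he.heightFiltration.nu =
    -((∑ p : UpperPair N, (p.height : ℝ)) / √(∑ p : UpperPair N, (p.height : ℝ) ^ 2)) := by
  have := he.finiteDimensional
  rw [LieFiltration.nu, LieFiltration.wt_eq_sum _ _ he.finrank_heightFiltration,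
    LieFiltration.norm_eq_sqrt_sum _ _ he.finrank_heightFiltration, neg_div]

theorem nu_of_isRescaling {F : LieFiltration k L} {c : ℕ}
    (hF : F.IsRescaling he.heightFiltration c) : F.nu = he.heightFiltration.nu := by
  have := he.finiteDimensional
  have hc : (0 : ℝ) < c := by exact_mod_cast hF.1
  rw [nu_heightFiltration, LieFiltration.nu,
    LieFiltration.wt_eq_sum _ _ (he.finrank_of_isRescaling hF),
    LieFiltration.norm_eq_sqrt_sum _ _ (he.finrank_of_isRescaling hF), neg_div]
  push_cast
  simp only [mul_pow]
  rw [← Finset.mul_sum, ← Finset.mul_sum, Real.sqrt_mul (by positivity), Real.sqrt_sq hc.le,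
    mul_div_mul_left _ _ hc.ne']

/-- A position of height one. -/
def _root_.UpperPair.first (hN : 1 < N) : UpperPair N :=
  ⟨(⟨0, by omega⟩, ⟨1, hN⟩), by simp [Fin.lt_def]⟩

theorem _root_.UpperPair.height_first (hN : 1 < N) : (first hN).height = 1 := by
  simp [height, first]

theorem nu_min (hN : 1 < N) (F : LieFiltration k L) :
    he.heightFiltration.nu ≤ F.nu ∧
      (F.nu ≤ he.heightFiltration.nu → ∃ c : ℕ, F.IsRescaling he.heightFiltration c) := by
  have := he.finiteDimensional
  obtain ⟨w, hlead, hrank⟩ := F.exists_leadingWeight he.coord key key_injective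
  have hsuper : ∀ (i j l : Fin N) (hij : i < j) (hjl : j < l),
      w ⟨(i, j), hij⟩ + w ⟨(j, l), hjl⟩ ≤ w ⟨(i, l), hij.trans hjl⟩ := by
    intro i j l hij hjl
    obtain ⟨x, hx, hx'⟩ := (hlead _ _).2 (le_refl (w ⟨(i, j), hij⟩))
    obtain ⟨y, hy, hy'⟩ := (hlead _ _).2 (le_refl (w ⟨(j, l), hjl⟩))
    exact (hlead _ _).1 ⟨⁅x, y⁆, F.lie_mem' _ _ x hx y hy, he.isLeadingAt_lie hij hjl hx' hy'⟩
  have hNR : (0 : ℝ) < N := by exact_mod_cast (by omega : 0 < N)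
  have h1 : (N : ℝ) * ∑ p, (w p : ℝ) ≤ 2 * ∑ p, (w p : ℝ) * (p.height : ℝ) := by
    exact_mod_cast sum_le_sum_mul_height w hsuper
  have h2 : (N : ℝ) * ∑ p : UpperPair N, (p.height : ℝ) =
      2 * ∑ p : UpperPair N, (p.height : ℝ) ^ 2 := by
    exact_mod_cast sum_height (N := N)
  have hpos : 0 < ∑ p : UpperPair N, (p.height : ℝ) ^ 2 := by
    refine Finset.sum_pos (fun p _ => ?_) ⟨first hN, Finset.mem_univ _⟩
    have : (0 : ℝ) < p.height := by exact_mod_cast p.height_pos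
    positivity
  -- The constant `2 / N` is the ratio in both the inequality for `w` and the equality for the
  -- height.
  obtain ⟨hmin, heq⟩ := sum_div_sqrt_le (fun p => (w p : ℝ)) (fun p => (p.height : ℝ)) (2 / N)
    (by positivity) (by field_simp; linarith) (by
      rw [div_mul_eq_mul_div, le_div_iff₀ hNR]
      linarith) hpos
  rw [nu_heightFiltration, LieFiltration.nu, F.wt_eq_sum w hrank, F.norm_eq_sqrt_sum w hrank,
    neg_div]
  refine ⟨neg_le_neg hmin, fun hle => ?_⟩
  obtain ⟨t, ht, hwt⟩ := heq (neg_le_neg_iff.1 hle)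
  -- A position of height one has weight `t`, so the proportionality factor is an integer.
  have ht1 : (w (first hN) : ℝ) = t := by
    rw [hwt, height_first]
    simp
  have hc0 : 0 < w (first hN) := by
    rw [← ht1] at ht
    exact_mod_cast ht
  obtain ⟨c, hc⟩ := Int.eq_ofNat_of_zero_le hc0.le
  have hcpos : 0 < c := by omega
  have hw : ∀ p, w p = c * p.height := by
    intro p
    have := hwt p
    rw [← ht1, hc] at this
    exact_mod_cast this
  refine ⟨c, hcpos, fun m => ?_⟩
  -- Height is the first component of the key, so an element has no entries of height below that of
  -- its leading position. This gives the inclusion, and the weights give equal dimensions.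
  apply Submodule.eq_of_le_of_finrank_eq
  · intro x hx
    rw [mem_heightFiltration']
    by_contra! hne
    obtain ⟨p, hp, hxp⟩ := hne
    have hx0 : x ≠ 0 := by
      rintro rfl
      simp at hxp
    obtain ⟨β, hβ⟩ := exists_isLeadingAt he.coord key hx0
    have hβm := (hlead m β).1 ⟨x, hx, hβ⟩
    rw [hw, ← ceil_le_height m hcpos] at hβm
    have hlt : p.key < β.key := by
      rw [key_lt_key]
      exact Or.inl (by omega)
    exact hxp (hβ.2 p hlt)
  · rw [hrank, finrank_heightFiltration]
    simp only [hw, ceil_le_height m hcpos]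

theorem not_isSemistableLie (he : IsStrictUpperModel e) (hN : 1 < N) : ¬ IsSemistableLie k L := by
  have := he.finiteDimensional
  intro h
  have h0 := h he.heightFiltration
  rw [LieFiltration.wt_eq_sum _ _ he.finrank_heightFiltration] at h0
  have : 0 < ∑ p : UpperPair N, (p.height : ℝ) := by
    refine Finset.sum_pos (fun p _ => ?_) ⟨first hN, Finset.mem_univ _⟩
    exact_mod_cast p.height_pos
  linarith

theorem heightFiltration_ne_succ (p : UpperPair N) :
    he.heightFiltration.piece p.height ≠ he.heightFiltration.piece (p.height + 1) := by
  classical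
  intro h
  have hmem : he.coord.symm (Pi.single p 1) ∈ he.heightFiltration.piece p.height := by
    rw [mem_heightFiltration']
    intro q hq
    have hne : q ≠ p := by
      rintro rfl
      omega
    simp [hne]
  rw [h, mem_heightFiltration'] at hmem
  simpa using hmem p (by omega)

theorem subsingleton (he : IsStrictUpperModel e) (hN : N ≤ 1) : Subsingleton L := by
  refine ⟨fun x y => he.injective ?_⟩
  ext i j
  rw [he.eq_zero x i j (by rw [Fin.le_def]; omega), he.eq_zero y i j (by rw [Fin.le_def]; omega)]

theorem isRescaling_one : he.heightFiltration.IsRescaling he.heightFiltration 1 :=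
  ⟨one_pos, fun m => by simp⟩

theorem isCanonicalUpToScaling_iff (F : LieFiltration k L) :
    F.IsCanonicalUpToScaling ↔ ∃ c : ℕ, F.IsRescaling he.heightFiltration c := by
  rcases le_or_gt N 1 with hN | hN
  · have := he.subsingleton hN
    have heq : ∀ F G : LieFiltration k L, F = G := fun F G => by
      ext1
      funext m
      exact Subsingleton.elim _ _
    refine iff_of_true ⟨fun _ => heq _ _, fun _ F' => by rw [heq F F']⟩ ⟨1, ?_⟩
    rw [heq F he.heightFiltration]
    exact he.isRescaling_one
  · have hns := he.not_isSemistableLie hN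
    constructor
    · exact fun h => (he.nu_min hN F).2 (h.2 hns _)
    · rintro ⟨c, hc⟩
      refine ⟨fun h => absurd h hns, fun _ F' => ?_⟩
      rw [he.nu_of_isRescaling hc]
      exact (he.nu_min hN F').1

theorem isCanonical_iff (F : LieFiltration k L) : F.IsCanonical ↔ F = he.heightFiltration := by
  rcases le_or_gt N 1 with hN | hN
  · have := he.subsingleton hN
    have heq : ∀ F G : LieFiltration k L, F = G := fun F G => by
      ext1
      funext m
      exact Subsingleton.elim _ _
    -- The zero algebra is semistable: indexing the weights by `Empty` gives `wt = 0`. So the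
    -- indivisibility clause is vacuous.
    refine iff_of_true ⟨⟨fun _ => heq _ _, fun _ F' => by rw [heq F F']⟩, fun h => ?_⟩ (heq _ _)
    exact absurd (fun F => by rw [LieFiltration.wt_eq_sum F (fun p : Empty => 0)] <;>
      simp [Subsingleton.elim _ (⊥ : Submodule k L)]) h
  · have hns := he.not_isSemistableLie hN
    constructor
    · rintro ⟨h1, h2⟩
      obtain ⟨c, hc⟩ := (he.isCanonicalUpToScaling_iff F).1 h1
      -- All weights of the rescaling are multiples of `c`: if `c ∤ m`, then `m ≤ c * h` and `m + 1
      -- ≤ c * h` are equivalent, so the pieces at `m` and `m + 1` agree.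
      have hc1 : c = 1 := by
        refine h2 hns c fun m hm => ?_
        by_contra hndvd
        apply hm
        rw [hc.2, hc.2]
        ext x
        rw [mem_heightFiltration', mem_heightFiltration']
        refine forall_congr' fun p => imp_congr_left ?_
        rw [← not_le, ← not_le, ceil_le_height _ hc.1, ceil_le_height _ hc.1, not_iff_not]
        constructor
        · intro hle
          exact lt_of_le_of_ne hle fun h => hndvd ⟨_, h⟩
        · intro hle
          omega
      ext1
      funext m
      rw [hc.2, hc1]
      simp
    · rintro rfl
      refine ⟨(he.isCanonicalUpToScaling_iff _).2 ⟨1, he.isRescaling_one⟩, fun _ d hd => ?_⟩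
      -- The number `1` is itself a weight, so only `1` divides all weights.
      have := hd _ (he.heightFiltration_ne_succ (first hN))
      rw [height_first] at this
      exact_mod_cast Int.eq_one_of_dvd_one (by omega) this

end IsStrictUpperModel

/-! ### Cartan subalgebras and bases of weight vectors -/

section WeightBasis

attribute [local instance] LieRing.ofAssociativeRing

/-- On `b i`, shifting `a` by the scalar `c i` does not change the commutator. It is then a sum of
commuting left and right multiplications by `a'` and `-a'`. In the binomial expansion of the power
`2n`, one factor has exponent at least `n` and kills the vector, since `x` and `a` preserve `W i`.
This puts diagonal endomorphisms in the zero root space. -/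
theorem commutator_pow_eq_zero_of_mapsTo {k V : Type*} [Field k] [AddCommGroup V] [Module k V]
    {ι : Type*} (b : Module.Basis ι k V) (a x : Module.End k V) (c : ι → k) (n : ℕ)
    (W : ι → Submodule k V) (hb : ∀ i, b i ∈ W i) (hx : ∀ i, ∀ y ∈ W i, x y ∈ W i)
    (ha : ∀ i, ∀ y ∈ W i, a y ∈ W i) (hn : ∀ i, ∀ y ∈ W i, ((a - c i • 1) ^ n) y = 0) :
    ((LinearMap.mulLeft k a - LinearMap.mulRight k a) ^ (2 * n)) x = 0 := by
  refine b.ext fun i => ?_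
  set a' : Module.End k V := a - c i • 1 with ha'
  have hD : LinearMap.mulLeft k a - LinearMap.mulRight k a =
      LinearMap.mulLeft k a' + LinearMap.mulRight k (-a') := by
    ext y : 1
    simp [ha', sub_mul, mul_sub]
  have hpow : ∀ m, ∀ y ∈ W i, ((-a') ^ m) y ∈ W i := by
    intro m
    induction m with
    | zero => intro y hy; simpa using hy
    | succ m ih =>
      intro y hy
      rw [pow_succ, Module.End.mul_apply]
      apply ih
      simp only [ha', LinearMap.neg_apply, LinearMap.sub_apply, LinearMap.smul_apply,
        Module.End.one_apply]
      exact (W i).neg_mem ((W i).sub_mem (ha i y hy) ((W i).smul_mem _ hy))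
  have hcomm : Commute (LinearMap.mulLeft k a') (LinearMap.mulRight k (-a')) :=
    LinearMap.commute_mulLeft_right a' (-a')
  rw [hD, hcomm.add_pow, LinearMap.sum_apply,
    LinearMap.sum_apply, LinearMap.zero_apply]
  refine Finset.sum_eq_zero fun p hp => ?_
  rw [← Nat.cast_comm, Module.End.mul_apply, Module.End.natCast_apply,
    LinearMap.smul_apply, LinearMap.pow_mulLeft, LinearMap.pow_mulRight, Module.End.mul_apply,
    LinearMap.mulLeft_apply, LinearMap.mulRight_apply, Module.End.mul_apply, Module.End.mul_apply]
  have hzero : ∀ m, n ≤ m → ∀ y ∈ W i, (a' ^ m) y = 0 := by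
    intro m hm y hy
    rw [← Nat.sub_add_cancel hm, pow_add, Module.End.mul_apply, hn i y hy, map_zero]
  rcases le_or_gt n p with h | h
  · rw [hzero p h _ (hx i _ (hpow _ _ (hb i))), smul_zero]
  · rw [neg_pow, Module.End.mul_apply, hzero _ (by omega) _ (hb i), map_zero, map_zero, map_zero,
      smul_zero]

/-- A triangularizable module over a nilpotent Lie algebra has a basis of generalized weight
vectors. -/
theorem exists_basis_mem_genWeightSpace {k H V ι : Type*} [Field k] [LieRing H] [LieAlgebra k H]
    [LieRing.IsNilpotent H] [AddCommGroup V] [Module k V] [FiniteDimensional k V]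
    [LieRingModule H V] [LieModule k H V] [LieModule.IsTriangularizable k H V] [Fintype ι]
    (hι : Fintype.card ι = Module.finrank k V) :
    ∃ (b : Module.Basis ι k V) (χ : ι → H → k), ∀ i, b i ∈ LieModule.genWeightSpace V (χ i) := by
  obtain ⟨s, hs, hspan, hli⟩ := exists_linearIndependent k
    (⋃ χ : H → k, (LieModule.genWeightSpace V χ : Set V))
  have htop : Submodule.span k (⋃ χ : H → k, (LieModule.genWeightSpace V χ : Set V)) = ⊤ := by
    have h := congrArg LieSubmodule.toSubmodule (LieModule.iSup_genWeightSpace_eq_top k H V)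
    rw [LieSubmodule.iSup_toSubmodule] at h
    rw [eq_top_iff, ← LieSubmodule.top_toSubmodule (R := k) (L := H), ← h, iSup_le_iff]
    intro χ x hx
    exact Submodule.subset_span (Set.mem_iUnion.2 ⟨χ, hx⟩)
  rw [htop] at hspan
  let b0 := Module.Basis.mk hli (by simp [hspan])
  have : Fintype s := FiniteDimensional.fintypeBasisIndex b0
  have hcard : Fintype.card s = Fintype.card ι := by
    rw [hι, Module.finrank_eq_card_basis b0]
  let b := b0.reindex (Fintype.equivOfCardEq hcard)
  have hb : ∀ i, ∃ χ : H → k, b i ∈ LieModule.genWeightSpace V χ := by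
    intro i
    have h1 : b i ∈ s := by simp [b, b0]
    simpa using hs h1
  choose χ hχ using hb
  exact ⟨b, χ, hχ⟩

/-- Generalized weight spaces are independent, so the part of `y` along basis vectors of other
weights must vanish. -/
theorem eq_of_repr_ne_zero {k H V ι : Type*} [Field k] [LieRing H] [LieAlgebra k H]
    [LieRing.IsNilpotent H] [AddCommGroup V] [Module k V]
    [LieRingModule H V] [LieModule k H V] [Fintype ι]
    {b : Module.Basis ι k V} {χ : ι → H → k} (hb : ∀ i, b i ∈ LieModule.genWeightSpace V (χ i))
    {θ : H → k} {y : V} (hy : y ∈ LieModule.genWeightSpace V θ) {i : ι} (hi : b.repr y i ≠ 0) :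
    χ i = θ := by
  classical
  by_contra hne
  have hind := LieModule.iSupIndep_genWeightSpace k H V
  rw [LieSubmodule.iSupIndep_toSubmodule.symm] at hind
  have hdis := Submodule.disjoint_def.1 (hind θ)
  set z := ∑ j ∈ Finset.univ.filter (fun j => χ j ≠ θ), b.repr y j • b j with hz
  set z' := ∑ j ∈ Finset.univ.filter (fun j => ¬ χ j ≠ θ), b.repr y j • b j with hz'
  have hsum : z + z' = y := by
    rw [hz, hz', Finset.sum_filter_add_sum_filter_not]
    exact b.sum_repr y
  have hz'mem : z' ∈ (LieModule.genWeightSpace V θ).toSubmodule := by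
    refine Submodule.sum_mem _ fun j hj => Submodule.smul_mem _ _ ?_
    have : χ j = θ := by simpa using hj
    rw [← this]
    exact hb j
  have hzθ : z ∈ (LieModule.genWeightSpace V θ).toSubmodule := by
    rw [← eq_sub_iff_add_eq] at hsum
    rw [hsum]
    exact Submodule.sub_mem _ hy hz'mem
  have hz0 : z = 0 := by
    refine hdis z hzθ ?_
    refine Submodule.sum_mem _ fun j hj => Submodule.smul_mem _ _ ?_
    have hj' : χ j ≠ θ := by simpa using hj
    exact Submodule.mem_iSup_of_mem (χ j) (Submodule.mem_iSup_of_mem hj' (hb j))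
  apply hi
  have hli := (linearIndependent_iff'.1 b.linearIndependent) _ _ (hz.symm.trans hz0) i
  exact hli (by simpa using hne)

/-- A Cartan subalgebra of the traceless endomorphisms consists of the endomorphisms which are
diagonal in a suitable basis. -/
theorem exists_basis_mem_cartan_iff {k L V ι : Type*} [Field k] [IsAlgClosed k] [CharZero k]
    [LieRing L] [LieAlgebra k L] [FiniteDimensional k L] [AddCommGroup V] [Module k V]
    [FiniteDimensional k V] [Fintype ι] (hι : Fintype.card ι = Module.finrank k V)
    (ψ : L →ₗ⁅k⁆ Module.End k V) (hψ : Function.Injective ψ)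
    (hrange : ∀ f : Module.End k V, LinearMap.trace k V f = 0 → ∃ x, ψ x = f)
    (H : LieSubalgebra k L) [H.IsCartanSubalgebra] :
    ∃ b : Module.Basis ι k V, ∀ x, x ∈ H ↔ ∀ i j, i ≠ j → b.repr (ψ x (b j)) i = 0 := by
  classical
  let : LieRingModule H V := LieRingModule.compLieHom V (ψ.comp H.incl)
  have : LieModule k H V := LieModule.compLieHom V (ψ.comp H.incl)
  have hact : ∀ h : H, LieModule.toEnd k H V h = ψ h := fun h => rfl
  obtain ⟨b, χ, hb⟩ := exists_basis_mem_genWeightSpace (k := k) (H := H) (V := V) hι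
  have hpow : ∀ (h : H) (θ : H → k), ∀ y ∈ LieModule.genWeightSpace V θ,
      ((ψ h - θ h • 1) ^ Module.finrank k V) y = 0 := by
    intro h θ y hy
    have h1 := LieModule.genWeightSpace_le_genWeightSpaceOf V h θ hy
    change y ∈ Module.End.maxGenEigenspace (LieModule.toEnd k H V h) (θ h) at h1
    rw [Module.End.maxGenEigenspace_eq_genEigenspace_finrank, Module.End.mem_genEigenspace_nat,
      hact] at h1
    exact h1
  -- An endomorphism diagonal in `b` preserves every weight space, so `ad h` is nilpotent on it. It
  -- thus lies in the zero root space, which is `H` itself because `H` is Cartan.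
  have hdiag : ∀ x, (∀ i j, i ≠ j → b.repr (ψ x (b j)) i = 0) → x ∈ H := by
    intro x hx
    have hx' : ∀ j, ψ x (b j) = b.repr (ψ x (b j)) j • b j := by
      intro j
      conv_lhs => rw [← b.sum_repr (ψ x (b j))]
      exact Finset.sum_eq_single j (fun i _ hij => by rw [hx i j hij, zero_smul]) (by simp)
    have hmem : x ∈ LieAlgebra.rootSpace H 0 := by
      rw [LieAlgebra.rootSpace, LieModule.mem_genWeightSpace]
      intro h
      refine ⟨2 * Module.finrank k V, ?_⟩
      have hcomm : ∀ m, ψ (((LieModule.toEnd k H L h) ^ m) x) =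
          ((LinearMap.mulLeft k (ψ h) - LinearMap.mulRight k (ψ h)) ^ m) (ψ x) := by
        intro m
        induction m with
        | zero => simp
        | succ m ih =>
          rw [pow_succ', pow_succ', Module.End.mul_apply, Module.End.mul_apply, ← ih]
          rw [LieModule.toEnd_apply_apply, LieSubalgebra.coe_bracket_of_module, LieHom.map_lie]
          rfl
      rw [Pi.zero_apply, zero_smul, sub_zero]
      apply hψ
      rw [hcomm, map_zero]
      refine commutator_pow_eq_zero_of_mapsTo b _ _ (fun i => χ i h) _
        (fun i => (LieModule.genWeightSpace V (χ i)).toSubmodule) hb ?_ ?_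
        fun i y hy => hpow h (χ i) y hy
      · intro i y hy
        rw [← b.sum_repr y, map_sum]
        refine Submodule.sum_mem _ fun j _ => ?_
        rw [map_smul, hx']
        by_cases h0 : b.repr y j = 0
        · rw [h0, zero_smul]
          exact Submodule.zero_mem _
        · refine Submodule.smul_mem _ _ (Submodule.smul_mem _ _ ?_)
          rw [← eq_of_repr_ne_zero hb hy h0]
          exact hb j
      · intro i y hy
        exact LieSubmodule.lie_mem _ (x := h) hy
    rw [LieAlgebra.rootSpace_zero_eq] at hmem
    exact hmem
  -- The weights are distinct: if `χ i = χ j`, the traceless diagonal endomorphism with entries `1`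
  -- at `i` and `-1` at `j` lies in `H` by `hdiag`. Its eigenvalues are the values of the weights on
  -- it, so `1 = -1`. Hence each weight space is a line and `H` acts diagonally.
  have hinj : Function.Injective χ := by
    intro i j hij
    by_contra hne
    let d : ι → k := Pi.single i 1 - Pi.single j 1
    let f : Module.End k V := b.constr k fun l => d l • b l
    have hf : ∀ l, f (b l) = d l • b l := fun l => b.constr_basis k _ l
    have htr : LinearMap.trace k V f = 0 := by
      rw [LinearMap.trace_eq_matrix_trace k b, Matrix.trace]
      have : ∀ l, (LinearMap.toMatrix b b f).diag l = d l := by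
        intro l
        rw [Matrix.diag_apply, LinearMap.toMatrix_apply, hf]
        simp
      simp only [this]
      simp [d]
    obtain ⟨x, hx⟩ := hrange f htr
    have hxH : x ∈ H := by
      apply hdiag
      intro p q hpq
      rw [hx, hf]
      simp [hpq.symm]
    have heig : ∀ l, d l = χ l ⟨x, hxH⟩ := by
      intro l
      have h1 := hpow ⟨x, hxH⟩ (χ l) (b l) (hb l)
      have h2 : ∀ m, ((ψ x - χ l ⟨x, hxH⟩ • (1 : Module.End k V)) ^ m) (b l) =
          (d l - χ l ⟨x, hxH⟩) ^ m • b l := by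
        intro m
        induction m with
        | zero => simp
        | succ m ih =>
          rw [pow_succ', Module.End.mul_apply, ih, map_smul, LinearMap.sub_apply, hx, hf,
            LinearMap.smul_apply, Module.End.one_apply, ← sub_smul, smul_smul, pow_succ]
      rw [h2] at h1
      have h3 := (smul_eq_zero.1 h1).resolve_right (b.ne_zero l)
      exact sub_eq_zero.1 (eq_zero_of_pow_eq_zero h3)
    have h1 := heig i
    have h2 := heig j
    rw [hij, ← h2] at h1
    simp only [d, Pi.sub_apply, Pi.single_eq_same, Pi.single_eq_of_ne hne,
      Pi.single_eq_of_ne (Ne.symm hne)] at h1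
    norm_num [sub_eq_iff_eq_add] at h1
  refine ⟨b, fun x => ⟨fun hx i j hij => ?_, hdiag x⟩⟩
  by_contra h0
  refine hij (hinj (eq_of_repr_ne_zero hb ?_ h0))
  exact LieSubmodule.lie_mem _ (x := (⟨x, hx⟩ : H)) (hb j)

end WeightBasis

/-! ### Roots of the special linear algebra in diagonalizing coordinates -/

section SpecialLinearCartan

open LieAlgebra.SpecialLinear

attribute [local instance] LieRing.ofAssociativeRing

/-- `T` is a trace preserving change of coordinates which identifies `H` with the traceless diagonal
matrices. -/
structure IsDiagonalizing {k ι : Type*} [Field k] [Fintype ι] [DecidableEq ι]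
    (H : LieSubalgebra k (sl ι k)) (T : Matrix ι ι k ≃ₐ[k] Matrix ι ι k) : Prop where
  trace_eq : ∀ A, (T A).trace = A.trace
  mem_iff : ∀ x : sl ι k, x ∈ H ↔ ∀ i j, i ≠ j → T x i j = 0

theorem mem_sl_iff {k ι : Type*} [Field k] [Fintype ι] [DecidableEq ι] (A : Matrix ι ι k) :
    A ∈ sl ι k ↔ A.trace = 0 := Iff.rfl

/-- Every Cartan subalgebra of `sl` is diagonal in suitable coordinates. -/
theorem exists_isDiagonalizing {k ι : Type*} [Field k] [IsAlgClosed k] [CharZero k] [Fintype ι]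
    [DecidableEq ι] (H : LieSubalgebra k (sl ι k)) [H.IsCartanSubalgebra] :
    ∃ T, IsDiagonalizing H T := by
  let ψ : sl ι k →ₗ⁅k⁆ Module.End k (ι → k) :=
    (lieEquivMatrix' (R := k) (n := ι)).symm.toLieHom.comp (sl ι k).incl
  have hψ : ∀ x : sl ι k, ψ x = Matrix.toLin' (x : Matrix ι ι k) := fun x => rfl
  obtain ⟨b, hb⟩ := exists_basis_mem_cartan_iff (ι := ι) (by simp) ψ
    (fun x y hxy => by
      rw [hψ, hψ] at hxy
      exact Subtype.ext (Matrix.toLin'.injective hxy))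
    (fun f hf => ⟨⟨LinearMap.toMatrix' f, by
      rw [mem_sl_iff, ← hf, LinearMap.trace_eq_matrix_trace k (Pi.basisFun k ι)]
      rfl⟩, by rw [hψ]; simp⟩) H
  refine ⟨Matrix.toLinAlgEquiv'.trans (LinearMap.toMatrixAlgEquiv b), fun A => ?_, fun x => ?_⟩
  · have h1 := LinearMap.trace_eq_matrix_trace k b (Matrix.toLin' A)
    have h2 := LinearMap.trace_eq_matrix_trace k (Pi.basisFun k ι) (Matrix.toLin' A)
    rw [h1] at h2
    have h3 : LinearMap.toMatrix (Pi.basisFun k ι) (Pi.basisFun k ι) (Matrix.toLin' A) = A :=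
      LinearMap.toMatrix'_toLin' A
    rw [h3] at h2
    exact h2
  · rw [hb]
    refine forall_congr' fun i => forall_congr' fun j => imp_congr_right fun _ => ?_
    rw [AlgEquiv.trans_apply, LinearMap.toMatrixAlgEquiv_apply, hψ]
    rfl

/-- The difference of the `i`-th and `j`-th diagonal entries, a function on `H`. -/
def diagDiff {k ι : Type*} [Field k] [Fintype ι] [DecidableEq ι] (H : LieSubalgebra k (sl ι k))
    (T : Matrix ι ι k ≃ₐ[k] Matrix ι ι k) (i j : ι) : H → k :=
  fun h => T ((h : sl ι k) : Matrix ι ι k) i i - T ((h : sl ι k) : Matrix ι ι k) j j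

namespace IsDiagonalizing

variable {k ι : Type*} [Field k] [Fintype ι] [DecidableEq ι]
  {H : LieSubalgebra k (sl ι k)} {T : Matrix ι ι k ≃ₐ[k] Matrix ι ι k}

theorem symm_mem_sl (hT : IsDiagonalizing H T) {A : Matrix ι ι k} (hA : A.trace = 0) :
    T.symm A ∈ sl ι k := by
  rw [mem_sl_iff, ← hT.trace_eq, AlgEquiv.apply_symm_apply, hA]

theorem exists_diag_eq (hT : IsDiagonalizing H T) (d : ι → k) (hd : ∑ i, d i = 0) :
    ∃ h : H, ∀ i, T ((h : sl ι k) : Matrix ι ι k) i i = d i := by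
  have hA : (Matrix.diagonal d).trace = 0 := by rw [Matrix.trace_diagonal, hd]
  refine ⟨⟨⟨T.symm (Matrix.diagonal d), hT.symm_mem_sl hA⟩, (hT.mem_iff _).2 fun i j hij => ?_⟩,
    fun i => ?_⟩
  · simp [hij]
  · simp

theorem diagDiff_add (i j l : ι) : diagDiff H T i j + diagDiff H T j l = diagDiff H T i l := by
  ext h
  simp [diagDiff]

theorem neg_diagDiff (i j : ι) : -diagDiff H T i j = diagDiff H T j i := by
  ext h
  simp [diagDiff]

/-- Evaluate at the diagonal element with entries `1` at `i` and `-1` at `j`. In characteristic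
zero, a difference of two of its entries equals `2` only for the pair `(i, j)`. -/
theorem diagDiff_injective [CharZero k] (hT : IsDiagonalizing H T) {i j p q : ι} (hij : i ≠ j)
    (h : diagDiff H T p q = diagDiff H T i j) : p = i ∧ q = j := by
  obtain ⟨x, hx⟩ := hT.exists_diag_eq (Pi.single i 1 - Pi.single j 1) (by simp)
  have h1 := congrFun h x
  simp only [diagDiff, hx, Pi.sub_apply, Pi.single_apply, if_neg hij, if_neg hij.symm] at h1
  split_ifs at h1 with h2 h3 h4 h5 h6 h7 h8 h9
  all_goals first
    | exact ⟨by assumption, by assumption⟩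
    | (exfalso; norm_num at h1)

/-- The operator `ad h - θ h` scales the `(i, j)` entry by `diagDiff H T i j h - θ h`. It is
therefore diagonal, and generalized root vectors are ordinary ones. -/
theorem mem_rootSpace_iff (hT : IsDiagonalizing H T) [LieRing.IsNilpotent H] (θ : H → k)
    (x : sl ι k) :
    x ∈ LieAlgebra.rootSpace H θ ↔
      ∀ i j, T (x : Matrix ι ι k) i j ≠ 0 → diagDiff H T i j = θ := by
  have key : ∀ (h : H) (y : sl ι k) (i j : ι),
      T (((LieModule.toEnd k H (sl ι k) h - θ h • 1) y : sl ι k) : Matrix ι ι k) i j =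
        (diagDiff H T i j h - θ h) * T (y : Matrix ι ι k) i j := by
    intro h y i j
    have hd : T ((h : sl ι k) : Matrix ι ι k) =
        Matrix.diagonal fun i => T ((h : sl ι k) : Matrix ι ι k) i i := by
      ext p q
      by_cases hpq : p = q
      · simp [hpq]
      · rw [(hT.mem_iff _).1 h.2 p q hpq, Matrix.diagonal_apply_ne _ hpq]
    have hco : (((LieModule.toEnd k H (sl ι k) h - θ h • 1) y : sl ι k) : Matrix ι ι k) =
        (h : sl ι k) * (y : Matrix ι ι k) - (y : Matrix ι ι k) * (h : sl ι k) -
          θ h • (y : Matrix ι ι k) := rfl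
    rw [hco, map_sub, map_sub, map_mul, map_mul, map_smul, Matrix.sub_apply, Matrix.sub_apply,
      Matrix.smul_apply, hd, Matrix.diagonal_mul, Matrix.mul_diagonal, smul_eq_mul, diagDiff]
    ring
  have hpow : ∀ (h : H) (m : ℕ) (i j : ι),
      T ((((LieModule.toEnd k H (sl ι k) h - θ h • 1) ^ m) x : sl ι k) : Matrix ι ι k) i j =
        (diagDiff H T i j h - θ h) ^ m * T (x : Matrix ι ι k) i j := by
    intro h m i j
    induction m with
    | zero => simp
    | succ m ih => rw [pow_succ', Module.End.mul_apply, key, ih, pow_succ', mul_assoc]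
  rw [LieAlgebra.rootSpace, LieModule.mem_genWeightSpace]
  constructor
  · intro hx i j hij
    ext h
    obtain ⟨m, hm⟩ := hx h
    have h1 := hpow h m i j
    rw [hm] at h1
    have h2 : (diagDiff H T i j h - θ h) ^ m * T (x : Matrix ι ι k) i j = 0 := by
      rw [← h1]
      simp
    exact sub_eq_zero.1 (eq_zero_of_pow_eq_zero ((mul_eq_zero.1 h2).resolve_right hij))
  · intro hx h
    refine ⟨1, Subtype.ext (T.injective ?_)⟩
    ext i j
    rw [hpow]
    by_cases h0 : T (x : Matrix ι ι k) i j = 0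
    · simp [h0]
    · simp [hx i j h0]

/-- A matrix with zero diagonal lies in the sum of the root spaces on which it is supported. -/
theorem mem_of_rootSpace_le (hT : IsDiagonalizing H T) [LieRing.IsNilpotent H]
    (x : sl ι k) (hx : ∀ i, T (x : Matrix ι ι k) i i = 0) (S : Submodule k (sl ι k))
    (hS : ∀ i j, T (x : Matrix ι ι k) i j ≠ 0 →
      (LieAlgebra.rootSpace H (diagDiff H T i j)).toSubmodule ≤ S) : x ∈ S := by
  have htr : ∀ i j, (Matrix.single i j (T (x : Matrix ι ι k) i j)).trace = 0 := by
    intro i j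
    by_cases hij : i = j
    · subst hij
      simp [hx]
    · exact Matrix.trace_single_eq_of_ne i j _ hij
  let comp : ι → ι → sl ι k := fun i j =>
    ⟨T.symm (Matrix.single i j (T (x : Matrix ι ι k) i j)), hT.symm_mem_sl (htr i j)⟩
  have hsum : x = ∑ i, ∑ j, comp i j := by
    apply Subtype.ext
    apply T.injective
    have hco : ((∑ i, ∑ j, comp i j : sl ι k) : Matrix ι ι k) =
        ∑ i, ∑ j, (comp i j : Matrix ι ι k) := by
      simp
    rw [hco, map_sum]
    simp only [map_sum, comp, AlgEquiv.apply_symm_apply]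
    exact Matrix.matrix_eq_sum_single _
  rw [hsum]
  refine Submodule.sum_mem _ fun i _ => Submodule.sum_mem _ fun j _ => ?_
  by_cases h0 : T (x : Matrix ι ι k) i j = 0
  · have : comp i j = 0 := Subtype.ext (by simp [comp, h0])
    rw [this]
    exact S.zero_mem
  · refine hS i j h0 ?_
    rw [LieSubmodule.mem_toSubmodule, hT.mem_rootSpace_iff]
    intro p q hpq
    simp only [comp, AlgEquiv.apply_symm_apply, Matrix.single_apply] at hpq
    have h1 : i = p ∧ j = q := by
      by_contra hn
      exact hpq (if_neg hn)
    rw [h1.1, h1.2]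

theorem isRootOf_diagDiff [CharZero k] (hT : IsDiagonalizing H T) [H.IsCartanSubalgebra] {i j : ι}
    (hij : i ≠ j) : IsRootOf H (diagDiff H T i j) := by
  constructor
  · intro h
    have h0 : diagDiff H T i i = 0 := by
      ext x
      simp [diagDiff]
    exact hij (hT.diagDiff_injective hij (h0.trans h.symm)).2
  · intro h
    have htr : (Matrix.single i j (1 : k)).trace = 0 := Matrix.trace_single_eq_of_ne i j _ hij
    have hmem : (⟨T.symm (Matrix.single i j 1), hT.symm_mem_sl htr⟩ : sl ι k) ∈
        LieAlgebra.rootSpace H (diagDiff H T i j) := by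
      rw [hT.mem_rootSpace_iff]
      intro p q hpq
      simp only [AlgEquiv.apply_symm_apply, Matrix.single_apply] at hpq
      have h1 : i = p ∧ j = q := by
        by_contra hn
        exact hpq (if_neg hn)
      rw [h1.1, h1.2]
    rw [h, LieSubmodule.mem_bot] at hmem
    have h1 := congrArg (fun y : sl ι k => T (y : Matrix ι ι k) i j) hmem
    simp at h1

theorem exists_eq_diagDiff (hT : IsDiagonalizing H T) [H.IsCartanSubalgebra] {θ : H → k}
    (hθ : IsRootOf H θ) : ∃ i j, i ≠ j ∧ θ = diagDiff H T i j := by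
  obtain ⟨h0, hne⟩ := hθ
  obtain ⟨x, hx, hx0⟩ := Submodule.exists_mem_ne_zero_of_ne_bot
    (mt (LieSubmodule.toSubmodule_eq_bot _).1 hne)
  have : ∃ i j, T (x : Matrix ι ι k) i j ≠ 0 := by
    by_contra! h
    apply hx0
    apply Subtype.ext
    apply T.injective
    ext i j
    simp [h]
  obtain ⟨i, j, hij⟩ := this
  have h1 := (hT.mem_rootSpace_iff θ x).1 hx i j hij
  refine ⟨i, j, ?_, h1.symm⟩
  rintro rfl
  apply h0
  rw [← h1]
  ext x
  simp [diagDiff]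

theorem reindex (hT : IsDiagonalizing H T) (σ : ι ≃ ι) :
    IsDiagonalizing H (T.trans (Matrix.reindexAlgEquiv k k σ)) where
  trace_eq A := by
    rw [← hT.trace_eq A, AlgEquiv.trans_apply]
    exact Equiv.sum_comp σ.symm fun i => T A i i
  mem_iff x := by
    rw [hT.mem_iff]
    constructor
    · intro h i j hij
      exact h _ _ (σ.symm.injective.ne hij)
    · intro h i j hij
      simpa using h (σ i) (σ j) (σ.injective.ne hij)

end IsDiagonalizing

/-- The coordinates can be ordered such that the positive roots are those above the diagonal. -/
theorem exists_isDiagonalizing_positive {k : Type*} [Field k] [IsAlgClosed k] [CharZero k] {N : ℕ}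
    (H : LieSubalgebra k (sl (Fin N) k)) [H.IsCartanSubalgebra]
    (P : Set (H → k)) (hP : IsPositiveSystem H P) :
    ∃ T, IsDiagonalizing H T ∧ ∀ i j, diagDiff H T i j ∈ P ↔ i < j := by
  classical
  obtain ⟨T, hT⟩ := exists_isDiagonalizing H
  -- The positive system makes `r` a strict total order: `0` is not a root, sums of positive roots
  -- that are roots are positive, and one of each opposite pair is positive. Sorting by `r` gives
  -- the permutation of coordinates.
  let r : Fin N → Fin N → Prop := fun i j => diagDiff H T i j ∈ P
  have hirr : ∀ i, ¬ r i i := fun i hi => (hP.isRoot _ hi).1 (by ext x; simp [diagDiff])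
  have htrans : ∀ i j l, r i j → r j l → r i l := by
    intro i j l hij hjl
    have hil : i ≠ l := by
      rintro rfl
      apply hP.neg_notMem _ hij
      rw [IsDiagonalizing.neg_diagDiff]
      exact hjl
    have h1 := hP.add_mem _ hij _ hjl
    rw [IsDiagonalizing.diagDiff_add] at h1
    exact h1 (hT.isRootOf_diagDiff hil)
  have htri : ∀ i j, i ≠ j → r i j ∨ r j i := by
    intro i j hij
    have h1 := hP.mem_or_neg_mem _ (hT.isRootOf_diagDiff hij)
    rw [IsDiagonalizing.neg_diagDiff] at h1
    exact h1
  have : IsStrictTotalOrder (Fin N) r :=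
    { irrefl := hirr
      trans := htrans
      trichotomous := fun i j h1 h2 => by
        by_contra hne
        exact (htri i j hne).elim h1 h2 }
  let σ := @Fintype.orderIsoFinOfCardEq (Fin N) (linearOrderOfSTO r) _ N (Fintype.card_fin N)
  have hσ : ∀ i j : Fin N, i < j ↔ r (σ i) (σ j) := fun i j =>
    (@OrderIso.lt_iff_lt _ _ _ (linearOrderOfSTO r).toPreorder σ i j).symm
  refine ⟨_, hT.reindex σ.toEquiv.symm, fun i j => ?_⟩
  rw [hσ]
  rfl

end SpecialLinearCartan

/-! ### Simple roots and the matrix model of the nilradical -/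

section BorelNilradical

open LieAlgebra.SpecialLinear

attribute [local instance] LieRing.ofAssociativeRing

theorem consecutiveSum_apply_eq_sub {k : Type*} [AddCommGroup k] {n : ℕ} (d : Fin (n + 1) → k)
    (i j : Fin (n + 1)) (hij : i ≤ j) :
    consecutiveSum (fun l : Fin n => d l.castSucc - d l.succ) i j = d i - d j := by
  induction j using Fin.induction with
  | zero =>
    have : i = 0 := Fin.le_zero_iff.1 hij
    simp [consecutiveSum, this]
  | succ j ih =>
    rcases hij.eq_or_lt with h | h
    · subst h
      rw [consecutiveSum, Finset.sum_eq_zero, sub_self]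
      intro l hl
      rw [Finset.mem_filter] at hl
      omega
    · have hle : i ≤ j.castSucc := by
        rw [Fin.lt_def, Fin.val_succ] at h
        rw [Fin.le_def, Fin.val_castSucc]
        omega
      have hfil : Finset.univ.filter
          (fun l : Fin n => (i : ℕ) ≤ (l : ℕ) ∧ (l : ℕ) < (j.succ : ℕ)) =
          insert j (Finset.univ.filter
            (fun l : Fin n => (i : ℕ) ≤ (l : ℕ) ∧ (l : ℕ) < (j.castSucc : ℕ))) := by
        ext l
        rw [Fin.le_def, Fin.val_castSucc] at hle
        simp only [Finset.mem_filter, Finset.mem_univ, true_and, Finset.mem_insert, Fin.val_succ,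
          Fin.val_castSucc, Fin.ext_iff]
        omega
      have ih' := ih hle
      rw [consecutiveSum] at ih' ⊢
      rw [hfil, Finset.sum_insert (by simp), ih']
      abel

variable {k : Type*} [Field k] {n : ℕ} {H : LieSubalgebra k (sl (Fin (n + 1)) k)}
  {T : Matrix (Fin (n + 1)) (Fin (n + 1)) k ≃ₐ[k] Matrix (Fin (n + 1)) (Fin (n + 1)) k}

theorem consecutiveSum_diagDiff (i j : Fin (n + 1)) (hij : i ≤ j) :
    consecutiveSum (fun l : Fin n => diagDiff H T l.castSucc l.succ) i j = diagDiff H T i j := by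
  ext h
  have h1 := consecutiveSum_apply_eq_sub
    (fun l => T ((h : sl (Fin (n + 1)) k) : Matrix (Fin (n + 1)) (Fin (n + 1)) k) l l) i j hij
  rw [consecutiveSum] at h1 ⊢
  rw [Finset.sum_apply]
  exact h1

theorem IsDiagonalizing.linearIndependent_diagDiff [CharZero k] (hT : IsDiagonalizing H T) :
    LinearIndependent k (fun l : Fin n => diagDiff H T l.castSucc l.succ) := by
  rw [Fintype.linearIndependent_iff]
  intro c hc l₀
  have hn : ((n : k) + 1) ≠ 0 := by exact_mod_cast Nat.succ_ne_zero n
  -- The test element is the fundamental coweight dual to the simple root `l₀`: `l₀ + 1` ones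
  -- followed by zeros, shifted by `s` to have trace zero. All other simple roots vanish on it.
  let s : k := ((l₀ : ℕ) + 1 : k) / (n + 1)
  obtain ⟨h, hh⟩ := hT.exists_diag_eq
    (fun i => (if i ≤ l₀.castSucc then (1 : k) else 0) - s) (by
      rw [Finset.sum_sub_distrib, ← Finset.sum_filter, Finset.sum_const, Finset.sum_const,
        show (Finset.univ.filter fun i => i ≤ l₀.castSucc) = Finset.Iic l₀.castSucc by ext; simp,
        Fin.card_Iic, Finset.card_univ, Fintype.card_fin]
      simp only [s, nsmul_eq_mul]
      push_cast
      field_simp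
      simp)
  have h1 := congrFun hc h
  rw [Finset.sum_apply, Finset.sum_eq_single l₀] at h1
  · simpa [diagDiff, hh, Fin.le_def] using h1
  · intro l _ hl
    have hl' : (l : ℕ) ≠ l₀ := fun h => hl (Fin.ext h)
    have hiff : (l : ℕ) + 1 ≤ l₀ ↔ (l : ℕ) ≤ l₀ := by omega
    simp only [Pi.smul_apply, diagDiff, hh, Fin.le_def, Fin.val_castSucc, Fin.val_succ, hiff,
      sub_self, smul_zero]
  · simp

variable [H.IsCartanSubalgebra] {P : Set (H → k)}

theorem IsDiagonalizing.mem_borelNilradical_iff [CharZero k] (hT : IsDiagonalizing H T)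
    (hP : IsPositiveSystem H P) (hTP : ∀ i j, diagDiff H T i j ∈ P ↔ i < j)
    (x : sl (Fin (n + 1)) k) :
    x ∈ borelNilradical H P hP ↔ ∀ i j, j ≤ i →
      T (x : Matrix (Fin (n + 1)) (Fin (n + 1)) k) i j = 0 := by
  constructor
  · let U : Submodule k (sl (Fin (n + 1)) k) :=
      { carrier := {x | ∀ i j, j ≤ i → T (x : Matrix (Fin (n + 1)) (Fin (n + 1)) k) i j = 0}
        add_mem' := fun {x y} hx hy i j hij => by
          change T ((x : Matrix (Fin (n + 1)) (Fin (n + 1)) k) + y) i j = 0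
          rw [map_add, Matrix.add_apply, hx i j hij, hy i j hij, add_zero]
        zero_mem' := fun i j _ => by simp
        smul_mem' := fun c x hx i j hij => by
          change T (c • (x : Matrix (Fin (n + 1)) (Fin (n + 1)) k)) i j = 0
          rw [map_smul, Matrix.smul_apply, hx i j hij, smul_zero] }
    have hle : (⨆ α ∈ P, (LieAlgebra.rootSpace H α).toSubmodule) ≤ U := by
      refine iSup₂_le fun α hα y hy i j hij => ?_
      by_contra hne
      have h1 := (hT.mem_rootSpace_iff α y).1 hy i j hne
      rw [← h1, hTP] at hα
      exact absurd hα (not_lt.2 hij)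
    exact fun hx => hle hx
  · intro hx
    refine hT.mem_of_rootSpace_le x (fun i => hx i i le_rfl)
      (⨆ α ∈ P, (LieAlgebra.rootSpace H α).toSubmodule) fun i j hij => ?_
    have hlt : i < j := by
      by_contra hn
      exact hij (hx i j (not_lt.1 hn))
    exact le_iSup₂_of_le (diagDiff H T i j) ((hTP i j).2 hlt) le_rfl

/-- The coordinate matrix of an element of the nilradical. -/
def nilradicalCoord (T : Matrix (Fin (n + 1)) (Fin (n + 1)) k ≃ₐ[k]
    Matrix (Fin (n + 1)) (Fin (n + 1)) k) (hP : IsPositiveSystem H P) :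
    borelNilradical H P hP →ₗ[k] Matrix (Fin (n + 1)) (Fin (n + 1)) k :=
  T.toLinearMap ∘ₗ (sl (Fin (n + 1)) k).toSubmodule.subtype ∘ₗ
    (borelNilradical H P hP).toSubmodule.subtype

theorem nilradicalCoord_apply (hP : IsPositiveSystem H P) (x : borelNilradical H P hP) :
    nilradicalCoord T hP x =
      T ((x : sl (Fin (n + 1)) k) : Matrix (Fin (n + 1)) (Fin (n + 1)) k) := rfl

theorem IsDiagonalizing.isStrictUpperModel [CharZero k] (hT : IsDiagonalizing H T)
    (hP : IsPositiveSystem H P) (hTP : ∀ i j, diagDiff H T i j ∈ P ↔ i < j) :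
    IsStrictUpperModel (nilradicalCoord T hP) where
  injective x y hxy := Subtype.ext (Subtype.ext (T.injective hxy))
  eq_zero x := (hT.mem_borelNilradical_iff hP hTP _).1 x.2
  exists_eq A hA := by
    have htr : A.trace = 0 := Finset.sum_eq_zero fun i _ => hA i i le_rfl
    refine ⟨⟨⟨T.symm A, hT.symm_mem_sl htr⟩, (hT.mem_borelNilradical_iff hP hTP _).2 ?_⟩, ?_⟩
    · simpa using hA
    · rw [nilradicalCoord_apply]
      simp
  map_lie x y := by
    rw [nilradicalCoord_apply, nilradicalCoord_apply, nilradicalCoord_apply, ← map_mul, ← map_mul,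
      ← map_sub]
    rfl

end BorelNilradical

/-! ### The canonical filtration of the nilradical -/

theorem mainTheorem11 {k : Type*} [Field k] [IsAlgClosed k] [CharZero k] (n : ℕ)
    (H : LieSubalgebra k (LieAlgebra.SpecialLinear.sl (Fin (n + 1)) k)) [H.IsCartanSubalgebra]
    (P : Set (H → k)) (hP : IsPositiveSystem H P) :
    ∃ α : Fin n → H → k,
      LinearIndependent k α ∧
      P = {β | ∃ i j : Fin (n + 1), i < j ∧ β = consecutiveSum α i j} ∧
      ∃ G : LieFiltration k (borelNilradical H P hP),
        (∀ m : ℤ, (G.piece m).map (borelNilradical H P hP).toSubmodule.subtype =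
          ⨆ (i : Fin (n + 1)) (j : Fin (n + 1)) (_ : i < j) (_ : m ≤ (j : ℤ) - (i : ℤ)),
            (LieAlgebra.rootSpace H (consecutiveSum α i j)).toSubmodule) ∧
        (∀ F : LieFiltration k (borelNilradical H P hP), F.IsCanonical ↔ F = G) ∧
        (∀ F : LieFiltration k (borelNilradical H P hP),
          F.IsCanonicalUpToScaling ↔ ∃ c : ℕ, F.IsRescaling G c) ∧
        (∀ i j : Fin (n + 1), i < j → ∀ x : borelNilradical H P hP, x ≠ 0 →
          (x : LieAlgebra.SpecialLinear.sl (Fin (n + 1)) k) ∈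
            LieAlgebra.rootSpace H (consecutiveSum α i j) →
          IsGreatest {m : ℤ | x ∈ G.piece m} ((j : ℤ) - (i : ℤ))) := by
  obtain ⟨T, hT, hTP⟩ := exists_isDiagonalizing_positive H P hP
  have he := hT.isStrictUpperModel hP hTP
  have hsum : ∀ i j : Fin (n + 1), i < j →
      consecutiveSum (fun l : Fin n => diagDiff H T l.castSucc l.succ) i j = diagDiff H T i j :=
    fun i j hij => consecutiveSum_diagDiff i j hij.le
  -- A vector in the root space of `β_{i,j}` has at most the single entry `(i, j)`, so its degree in
  -- the height filtration can be read off.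
  have hsupp : ∀ (i j : Fin (n + 1)), i < j → ∀ x : LieAlgebra.SpecialLinear.sl (Fin (n + 1)) k,
      x ∈ LieAlgebra.rootSpace H (diagDiff H T i j) → ∀ p q,
      T (x : Matrix (Fin (n + 1)) (Fin (n + 1)) k) p q ≠ 0 → p = i ∧ q = j :=
    fun i j hij x hx p q hpq =>
      hT.diagDiff_injective hij.ne ((hT.mem_rootSpace_iff _ x).1 hx p q hpq)
  refine ⟨fun l => diagDiff H T l.castSucc l.succ, hT.linearIndependent_diagDiff, ?_,
    he.heightFiltration, fun m => ?_, he.isCanonical_iff, he.isCanonicalUpToScaling_iff, ?_⟩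
  · ext β
    constructor
    · intro hβ
      obtain ⟨i, j, _, rfl⟩ := hT.exists_eq_diagDiff (hP.isRoot β hβ)
      rw [hTP] at hβ
      exact ⟨i, j, hβ, (hsum i j hβ).symm⟩
    · rintro ⟨i, j, hij, rfl⟩
      rw [hsum i j hij, hTP]
      exact hij
  · apply le_antisymm
    · rintro _ ⟨x, hx, rfl⟩
      have hup := he.eq_zero x
      refine hT.mem_of_rootSpace_le _ (fun i => hup i i le_rfl) _ fun i j hij => ?_
      have hlt : i < j := by
        by_contra hn
        exact hij (hup i j (not_lt.1 hn))
      have hm : m ≤ (j : ℤ) - (i : ℤ) := by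
        by_contra hn
        exact hij (hx i j (not_le.1 hn))
      refine le_iSup_of_le i (le_iSup_of_le j (le_iSup_of_le hlt (le_iSup_of_le hm ?_)))
      rw [hsum i j hlt]
    · refine iSup_le fun i => iSup_le fun j => iSup_le fun hij => iSup_le fun hm => ?_
      rw [hsum i j hij]
      intro y hy
      have hsy := hsupp i j hij y hy
      have hyn : y ∈ borelNilradical H P hP := by
        rw [hT.mem_borelNilradical_iff hP hTP]
        intro p q hqp
        by_contra hne
        obtain ⟨rfl, rfl⟩ := hsy p q hne
        exact absurd hij (not_lt.2 hqp)
      refine ⟨⟨y, hyn⟩, fun p q hpq => ?_, rfl⟩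
      by_contra hne
      obtain ⟨rfl, rfl⟩ := hsy p q hne
      omega
  · intro i j hij x hx0 hx
    rw [hsum i j hij] at hx
    have hsx := hsupp i j hij x hx
    constructor
    · intro p q hpq
      by_contra hne
      obtain ⟨rfl, rfl⟩ := hsx p q hne
      omega
    · intro m hm
      by_contra hlt
      apply hx0
      apply he.injective
      ext p q
      rw [map_zero, Matrix.zero_apply]
      by_contra hne
      obtain ⟨rfl, rfl⟩ := hsx p q hne
      exact hne (hm p q (not_le.1 hlt))
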